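/- Let $F\in\mathbb{S}^p[x]$ and $G_k\in\mathbb{S}^{q_k}[x]$, $k=1,\dots,m$, be symmetric matrices with entries in $\mathbb{R}[x]=\mathbb{R}[x_1,\dots,x_n]$, and let $\mathbf{K}=\{x\in\mathbb{R}^n : G_k(x)\succeq 0,\ k=1,\dots,m\}$. A symmetric polynomial matrix $S$ is called an SOS matrix if $S=T^{\intercal}T$ for some polynomial matrix $T$ (with any number of rows). For a $pq\times pq$ matrix $C=[C_{ij}]_{i,j=1}^p$ with blocks $C_{ij}$ of size $q\times q$ and a $q\times q$ matrix $D$, let $\langle C,D\rangle_p$ be the $p\times p$ matrix with entries $\mathrm{tr}(C_{ij}^{\intercal}D)$. The quadratic module generated by $G_1,\dots,G_m$ is called Archimedean if there are $a\ge 0$ and SOS matrices $\sigma_0$ of size $1\times 1$ and $\sigma_k$ of size $q_k\times q_k$ such that $a-\sum_{i=1}^n x_i^2=\sigma_0+\sum_{k=1}^m\langle\sigma_k,G_k\rangle_1$. A sign symmetry of a polynomial matrix $P$ is a vector $\theta\in\{-1,1\}^n$ with $P(x)=P(\theta_1x_1,\dots,\theta_nx_n)$ for all $x\in\mathbb{R}^n$.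 Let $R$ be the binary matrix with $n$ rows whose columns are all the common sign symmetries $\theta$ of $F,G_1,\dots,G_m$, each one written as a vector in $\{0,1\}^n$ whose $i$-th entry is $1$ if $\theta_i=-1$ and $0$ if $\theta_i=1$. The support $\mathrm{supp}(S)$ of a polynomial matrix $S=\sum_\alpha S_\alpha x^\alpha$ is the set of $\alpha\in\mathbb{N}^n$ with $S_\alpha\neq 0$. Suppose that the quadratic module generated by $G_1,\dots,G_m$ is Archimedean and that $F(x)$ is positive definite for every $x\in\mathbf{K}$. Then there are SOS matrices $S_0$ of size $p\times p$ and $S_k$ of size $pq_k\times pq_k$, $k=1,\dots,m$, such that $$F=S_0+\sum_{k=1}^m\langle S_k,G_k\rangle_p$$ and $R^{\intercal}\alpha\equiv 0\ (\mathrm{mod}\ 2)$ for every $\alpha\in\mathrm{supp}(S_k)$ and every $k=0,1,\dots,m$. -/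

import Mathlib

open MvPolynomial Matrix

namespace PolyMat

/-- Real polynomial matrices in the variables `x_1, …, x_n`. -/
abbrev PMatrix (n : ℕ) (ι κ : Type) : Type := Matrix ι κ (MvPolynomial (Fin n) ℝ)

/-- The real matrix `F(x)`. -/
noncomputable def evalAt {n : ℕ} {ι κ : Type} (F : PMatrix n ι κ) (x : Fin n → ℝ) : Matrix ι κ ℝ :=
  F.map (MvPolynomial.eval x)

/-- The coefficient matrix `F_α` of the monomial `x^α` in `F`. -/
noncomputable def coeffMatrix {n : ℕ} {ι κ : Type} (F : PMatrix n ι κ) (α : Fin n →₀ ℕ) :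
    Matrix ι κ ℝ :=
  F.map (MvPolynomial.coeff α)

/-- The support of a polynomial matrix: all `α` with `F_α ≠ 0`. -/
def supp {n : ℕ} {ι κ : Type} (F : PMatrix n ι κ) : Set (Fin n →₀ ℕ) :=
  {α | coeffMatrix F α ≠ 0}

/-- `F` is an SOS matrix: `F = Rᵀ R` for some polynomial matrix `R` with any number `s` of rows. -/
def IsSOS {n : ℕ} {ι : Type} (F : PMatrix n ι ι) : Prop :=
  ∃ (s : ℕ) (R : PMatrix n (Fin s) ι), F = Rᵀ * R

/-- The block `C_{ij}` of size `q × q` of a `pq × pq` matrix. -/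
def block {A : Type} {p q : ℕ} (C : Matrix (Fin p × Fin q) (Fin p × Fin q) A) (i j : Fin p) :
    Matrix (Fin q) (Fin q) A :=
  Matrix.of fun a b => C (i, a) (j, b)

/-- The `p`-product `⟨C, D⟩_p`, whose `(i, j)` entry is `tr (C_{ij}ᵀ D)`. -/
def pProduct {A : Type} [CommRing A] {p q : ℕ} (C : Matrix (Fin p × Fin q) (Fin p × Fin q) A)
    (D : Matrix (Fin q) (Fin q) A) : Matrix (Fin p) (Fin p) A :=
  Matrix.of fun i j => ((block C i j)ᵀ * D).trace

/-- The basic semialgebraic set `K = {x | G_k(x) ⪰ 0 for all k}`. -/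
def semialgebraicSet {n m : ℕ} {q : Fin m → ℕ}
    (G : (k : Fin m) → PMatrix n (Fin (q k)) (Fin (q k))) : Set (Fin n → ℝ) :=
  {x | ∀ k, (evalAt (G k) x).PosSemidef}

/-- The quadratic module `Σ^p[G]`: all `S_0 + ∑_k ⟨S_k, G_k⟩_p` with SOS matrices `S_0, …, S_m`. -/
def quadraticModule {n m : ℕ} (p : ℕ) {q : Fin m → ℕ}
    (G : (k : Fin m) → PMatrix n (Fin (q k)) (Fin (q k))) : Set (PMatrix n (Fin p) (Fin p)) :=
  {F | ∃ (S₀ : PMatrix n (Fin p) (Fin p))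
      (S : (k : Fin m) → PMatrix n (Fin p × Fin (q k)) (Fin p × Fin (q k))),
      IsSOS S₀ ∧ (∀ k, IsSOS (S k)) ∧ F = S₀ + ∑ k, pProduct (S k) (G k)}

/-- The Archimedean property of the quadratic module generated by `G`: for some `a ≥ 0` the scalar
polynomial `a - ‖x‖₂²`, as a `1 × 1` matrix, lies in `Σ^1[G]`. -/
def IsArchimedean {n m : ℕ} {q : Fin m → ℕ}
    (G : (k : Fin m) → PMatrix n (Fin (q k)) (Fin (q k))) : Prop :=
  ∃ a : ℝ, 0 ≤ a ∧
    (Matrix.of fun _ _ => C a - ∑ i, X i ^ 2 : PMatrix n (Fin 1) (Fin 1)) ∈ quadraticModule 1 G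

/-- `θ ∈ {-1, 1}^n` is a sign symmetry of `P` if `P(x) = P(θ ∘ x)` for all `x ∈ ℝ^n`. -/
def IsSignSymmetry {n : ℕ} {ι : Type} (P : PMatrix n ι ι) (θ : Fin n → ℤˣ) : Prop :=
  ∀ x : Fin n → ℝ, evalAt P x = evalAt P (fun i => ((θ i : ℤ) : ℝ) * x i)

/-- The common sign symmetries of `F, G_1, …, G_m`. -/
def commonSignSymmetries {n m p : ℕ} {q : Fin m → ℕ} (F : PMatrix n (Fin p) (Fin p))
    (G : (k : Fin m) → PMatrix n (Fin (q k)) (Fin (q k))) : Set (Fin n → ℤˣ) :=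
  {θ | IsSignSymmetry F θ ∧ ∀ k, IsSignSymmetry (G k) θ}

/-- The binary matrix `R` whose columns are the common sign symmetries of `F, G_1, …, G_m`,
written over `{0, 1}` with `-1` recorded as `1` and `+1` recorded as `0`. -/
def signMatrix {n m p : ℕ} {q : Fin m → ℕ} (F : PMatrix n (Fin p) (Fin p))
    (G : (k : Fin m) → PMatrix n (Fin (q k)) (Fin (q k))) :
    Matrix (Fin n) (commonSignSymmetries F G) (ZMod 2) :=
  Matrix.of fun i θ => if θ.1 i = -1 then 1 else 0

/-- The condition `Rᵀ α ≡ 0 (mod 2)`. -/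
def IsEvenFor {n : ℕ} {σ : Type} (R : Matrix (Fin n) σ (ZMod 2)) (α : Fin n →₀ ℕ) : Prop :=
  Rᵀ *ᵥ (fun i => (α i : ZMod 2)) = 0

end PolyMat

/-! A certificate without the parity condition is found first and then symmetrized.

Existence is the matrix Positivstellensatz `IsArchimedean.mem_quadraticModule`. If `F` were not in
the quadratic module, Riesz extension would give a state `L`, nonnegative on the module, with `L F ≤
0`. Among the states that minimize `L F`, an extreme point satisfies `L (f • A) = L (f • 1) * L A`
(`exists_multiplicative_state`). Scalar polynomials thus act by evaluation at a point `x`, which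
lies in `K`, and `L F` depends only on the constant matrix `F(x)`. Since `F(x)` is positive
definite, `L F > 0` by `pos_of_posDef`, a contradiction.

For the parity condition, the common sign symmetries form a finite group fixing `F` and every `G_k`.
Averaging the certificate over it leaves `F` and the `G_k` unchanged, keeps the multipliers SOS and
makes them invariant. A substitution `θ` multiplies the coefficient of `x^α` by `∏ θ_i^{α_i}`, so in
an invariant matrix only exponents on which this sign is `1` for every `θ` survive, which is `Rᵀ α ≡
0`. -/

/-- A convex sequence that is bounded above, after rescaling by powers of `N`, does not increase. -/
theorem le_mul_of_rescaled_convex_of_bounded {a : ℕ → ℝ} {N c : ℝ} (hN : 0 < N)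
    (hconv : ∀ k, 0 ≤ a (k + 2) - 2 * N * a (k + 1) + N ^ 2 * a k)
    (hbd : ∀ k, a k ≤ c * N ^ k) : a 1 ≤ N * a 0 := by
  by_contra! hlt
  set b := a 1 - N * a 0 with hb
  have hbpos : 0 < b := by linarith
  have hstep : ∀ k, N ^ k * b ≤ a (k + 1) - N * a k := by
    intro k
    induction k with
    | zero => simp [hb]
    | succ k ih =>
      have h1 := hconv k
      have h2 := mul_le_mul_of_nonneg_left ih hN.le
      rw [pow_succ]
      nlinarith
  have hgrow : ∀ k : ℕ, N ^ k * (N * a 0 + k * b) ≤ N * a k := by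
    intro k
    induction k with
    | zero => simp
    | succ k ih =>
      have h1 := mul_le_mul_of_nonneg_left (hstep k) hN.le
      have h2 := mul_le_mul_of_nonneg_left ih hN.le
      rw [pow_succ]
      push_cast
      nlinarith
  obtain ⟨k, hk⟩ := exists_nat_gt ((N * c - N * a 0) / b)
  rw [div_lt_iff₀ hbpos] at hk
  have h1 := (hgrow k).trans (mul_le_mul_of_nonneg_left (hbd k) hN.le)
  have h2 : N ^ k * (N * a 0 + k * b) ≤ N ^ k * (N * c) := by linarith
  have h3 := le_of_mul_le_mul_left h2 (pow_pos hN k)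
  linarith

/-! ### Archimedean cones and multiplicative states -/

/-- A cone `M` in a module `V` over a real algebra `R` that is stable under multiplication by squares
of `R` and has an order unit `e`, with respect to which the even powers of each element of `R`
grow at most geometrically. -/
structure IsArchimedeanCone {R V : Type*} [CommRing R] [Algebra ℝ R] [AddCommGroup V] [Module R V]
    [Module ℝ V] (M : Set V) (e : V) : Prop where
  unit_mem : e ∈ M
  add_mem : ∀ {A B}, A ∈ M → B ∈ M → A + B ∈ M
  sq_smul_mem : ∀ (f : R) {A}, A ∈ M → f ^ 2 • A ∈ M
  exists_sub_mem : ∀ A, ∃ c : ℝ, c • e - A ∈ M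
  exists_bound : ∀ f : R, ∃ N : ℝ, 0 < N ∧ ∀ k : ℕ, N ^ k • e - f ^ (2 * k) • e ∈ M

/-- The normalized linear functionals that are nonnegative on `M`. -/
def stateSet {V : Type*} [AddCommGroup V] [Module ℝ V] (M : Set V) (e : V) : Set (V → ℝ) :=
  {L | (∀ A B, L (A + B) = L A + L B) ∧ (∀ (c : ℝ) A, L (c • A) = c * L A) ∧
    (∀ A ∈ M, 0 ≤ L A) ∧ L e = 1}

namespace IsArchimedeanCone

variable {R V : Type*} [CommRing R] [Algebra ℝ R] [AddCommGroup V] [Module R V]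
    [Module ℝ V] {M : Set V} {e : V}

theorem state_eq_zero (hM : IsArchimedeanCone (R := R) M e) {L : V →ₗ[ℝ] ℝ}
    (hL : ∀ A ∈ M, 0 ≤ L A) (he : L e = 0) (A : V) : L A = 0 := by
  obtain ⟨c, hc⟩ := hM.exists_sub_mem A
  obtain ⟨d, hd⟩ := hM.exists_sub_mem (-A)
  have h1 := hL _ hc
  have h2 := hL _ hd
  simp only [map_sub, map_smul, map_neg, he, smul_zero] at h1 h2
  linarith

/-- The order unit confines each value `L A` to a fixed interval, so Tychonoff applies to states
viewed as plain functions with the product topology. -/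
theorem isCompact_stateSet (hM : IsArchimedeanCone (R := R) M e) : IsCompact (stateSet M e) := by
  choose c hc using hM.exists_sub_mem
  have hsub : stateSet M e ⊆ Set.univ.pi fun A => Set.Icc (-c (-A)) (c A) := by
    rintro L ⟨hadd, hsmul, hpos, hone⟩ A -
    have hneg : ∀ B, L (-B) = -L B := fun B => by
      rw [← neg_one_smul ℝ B, hsmul]; ring
    have h1 := hpos _ (hc A)
    have h2 := hpos _ (hc (-A))
    rw [sub_eq_add_neg, hadd, hsmul, hone, hneg] at h1 h2
    rw [hneg] at h2
    constructor <;> linarith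
  refine (isCompact_univ_pi fun A => isCompact_Icc).of_isClosed_subset ?_ hsub
  simp only [stateSet, Set.ofPred_and, Set.ofPred_forall]
  refine IsClosed.inter ?_ (IsClosed.inter ?_ (IsClosed.inter ?_ ?_))
  · exact isClosed_iInter fun A => isClosed_iInter fun B =>
      isClosed_eq (continuous_apply _) (by fun_prop)
  · exact isClosed_iInter fun r => isClosed_iInter fun A =>
      isClosed_eq (continuous_apply _) (continuous_const.mul (continuous_apply _))
  · exact isClosed_iInter fun A => isClosed_iInter fun _ =>
      isClosed_le continuous_const (continuous_apply _)
  · exact isClosed_eq (continuous_apply _) continuous_const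

variable [IsScalarTower ℝ R V]

theorem smul_mem (hM : IsArchimedeanCone (R := R) M e) {c : ℝ} (hc : 0 ≤ c) {A : V} (hA : A ∈ M) :
    c • A ∈ M := by
  have h := hM.sq_smul_mem (algebraMap ℝ R √c) hA
  rwa [← map_pow, Real.sq_sqrt hc, algebraMap_smul] at h

theorem zero_mem (hM : IsArchimedeanCone (R := R) M e) : (0 : V) ∈ M := by
  simpa using hM.smul_mem le_rfl hM.unit_mem

theorem exists_state (hM : IsArchimedeanCone (R := R) M e) {F : V} (hF : F ∉ M) :
    ∃ L : V →ₗ[ℝ] ℝ, (∀ A ∈ M, 0 ≤ L A) ∧ L e = 1 ∧ L F ≤ 0 := by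
  have hneg : -e ∉ M := by
    intro h
    obtain ⟨c, hc⟩ := hM.exists_sub_mem (-F)
    have h1 : -(|c| • e) ∈ M := by
      rw [← smul_neg]; exact hM.smul_mem (abs_nonneg c) h
    have h2 : (|c| - c) • e ∈ M := hM.smul_mem (sub_nonneg.2 (le_abs_self c)) hM.unit_mem
    apply hF
    convert hM.add_mem (hM.add_mem hc h1) h2 using 1
    rw [sub_smul]; abel
  have he : e ≠ 0 := by
    rintro rfl
    exact hneg (by simpa using hM.zero_mem)
  -- The cone `M - ℝ≥0 F`: nonnegativity on it encodes both positivity on `M` and `L F ≤ 0`. The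
  -- functional `c • e ↦ c` is extended from the line through `e`.
  let s : PointedCone ℝ V :=
    { carrier := {B | ∃ A ∈ M, ∃ t : ℝ, 0 ≤ t ∧ B = A - t • F}
      zero_mem' := ⟨0, hM.zero_mem, 0, le_rfl, by simp⟩
      smul_mem' := by
        rintro ⟨c, hc⟩ _ ⟨A, hA, t, ht, rfl⟩
        exact ⟨c • A, hM.smul_mem hc hA, c * t, by positivity, by
          rw [mul_smul, ← smul_sub]; rfl⟩
      add_mem' := by
        rintro _ _ ⟨A, hA, t, ht, rfl⟩ ⟨B, hB, u, hu, rfl⟩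
        exact ⟨A + B, hM.add_mem hA hB, t + u, by positivity, by rw [add_smul]; abel⟩ }
  have hMs : ∀ A ∈ M, A ∈ s := fun A hA => ⟨A, hA, 0, le_rfl, by simp⟩
  let f : V →ₗ.[ℝ] ℝ := LinearPMap.mkSpanSingleton e 1 he
  have hfe : ∀ (c : ℝ) (h : c • e ∈ f.domain), f ⟨c • e, h⟩ = c := by
    intro c h
    have := LinearPMap.mkSpanSingleton'_apply e (1 : ℝ)
      (fun c hc => by simp [(smul_eq_zero.1 hc).resolve_right he]) c h
    exact this.trans (mul_one c)
  have hdom : ∀ c : ℝ, c • e ∈ f.domain := fun c => Submodule.mem_span_singleton.2 ⟨c, rfl⟩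
  obtain ⟨L, hL, hLs⟩ := riesz_extension s f (by
      rintro ⟨x, hx⟩ hxs
      obtain ⟨c, rfl⟩ := Submodule.mem_span_singleton.1 hx
      rw [hfe]
      obtain ⟨A, hA, t, ht, hAt⟩ := hxs
      -- If `c • e = A - t • F` with `c < 0`, then `t • F ∈ M`; this forces `F ∈ M` when `t > 0` and
      -- `-e ∈ M` when `t = 0`.
      by_contra! hc
      have h1 : t • F ∈ M := by
        convert hM.add_mem hA (hM.smul_mem (neg_nonneg.2 hc.le) hM.unit_mem) using 1
        simp only at hAt
        rw [neg_smul, hAt]; abel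
      rcases ht.eq_or_lt with rfl | htpos
      · simp only [zero_smul, sub_zero] at hAt
        apply hneg
        have h2 := hM.smul_mem (inv_nonneg.2 (neg_nonneg.2 hc.le)) hA
        rw [← hAt, smul_smul] at h2
        convert h2 using 1
        have hc0 : c ≠ 0 := hc.ne
        rw [show (-c)⁻¹ * c = -1 by field_simp, neg_one_smul]
      · apply hF
        have h2 := hM.smul_mem (inv_nonneg.2 ht) h1
        rwa [smul_smul, inv_mul_cancel₀ htpos.ne', one_smul] at h2) (by
      intro y
      obtain ⟨c, hc⟩ := hM.exists_sub_mem (-y)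
      refine ⟨⟨c • e, hdom c⟩, hMs _ ?_⟩
      simpa using hc)
  refine ⟨L, fun A hA => hLs A (hMs A hA), ?_, ?_⟩
  · have h := hL ⟨(1 : ℝ) • e, hdom 1⟩
    rw [hfe] at h
    simpa using h
  · have h := hLs (-F) ⟨0, hM.zero_mem, 1, zero_le_one, by simp⟩
    rw [map_neg] at h
    linarith

/-- `N • A - f ^ 2 • A` need not lie in `M`, since only squares are known to preserve `M`; the
inequality is recovered after applying `L`. The sequence `L (f ^ (2 * k) • A)`, divided by `N ^ k`,
is convex because `(f ^ k * (f ^ 2 - N)) ^ 2 • A ∈ M`, and bounded because `A` is dominated by a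
multiple of `e`. -/
theorem exists_sq_smul_le (hM : IsArchimedeanCone (R := R) M e) (f : R) :
    ∃ N : ℝ, 0 < N ∧ ∀ L : V →ₗ[ℝ] ℝ, (∀ A ∈ M, 0 ≤ L A) → ∀ A ∈ M, L (f ^ 2 • A) ≤ N * L A := by
  obtain ⟨N, hN, hbd⟩ := hM.exists_bound f
  refine ⟨N, hN, fun L hL A hA => ?_⟩
  obtain ⟨c, hc⟩ := hM.exists_sub_mem A
  have key := le_mul_of_rescaled_convex_of_bounded (a := fun k => L (f ^ (2 * k) • A))
    (c := |c| * L e) hN ?_ ?_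
  · simpa using key
  · intro k
    have h := hL _ (hM.sq_smul_mem (f ^ k * (f ^ 2 - algebraMap ℝ R N)) hA)
    have h2 : (f ^ k * (f ^ 2 - algebraMap ℝ R N)) ^ 2 • A = f ^ (2 * (k + 2)) • A
        - (2 * N) • f ^ (2 * (k + 1)) • A + N ^ 2 • f ^ (2 * k) • A := by
      rw [← algebraMap_smul R (2 * N), ← algebraMap_smul R (N ^ 2), smul_smul, smul_smul,
        ← sub_smul, ← add_smul]
      congr 1
      simp only [map_mul, map_pow, map_ofNat]
      ring
    rw [h2] at h
    simpa using h
  · intro k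
    have h1 := hL _ (hM.sq_smul_mem (f ^ k) hc)
    have h2 := hL _ (hbd k)
    have h3 := hL _ (hM.sq_smul_mem (f ^ k) hM.unit_mem)
    rw [← pow_mul, mul_comm k 2] at h1 h3
    rw [smul_sub, smul_comm, map_sub, map_smul] at h1
    rw [map_sub, map_smul] at h2
    simp only [smul_eq_mul] at h1 h2
    have h4 : c * L (f ^ (2 * k) • e) ≤ |c| * L (f ^ (2 * k) • e) :=
      mul_le_mul_of_nonneg_right (le_abs_self c) h3
    have h5 := mul_le_mul_of_nonneg_left (sub_nonneg.1 h2) (abs_nonneg c)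
    calc L (f ^ (2 * k) • A) ≤ |c| * (N ^ k * L e) := by linarith
      _ = |c| * L e * N ^ k := by ring

/-- An element outside an Archimedean cone is not positive under some state along which the
scalars act by a character. -/
theorem exists_multiplicative_state (hM : IsArchimedeanCone (R := R) M e) {F : V} (hF : F ∉ M) :
    ∃ L : V →ₗ[ℝ] ℝ, (∀ A ∈ M, 0 ≤ L A) ∧ L e = 1 ∧ L F ≤ 0 ∧
      ∀ (f : R) A, L (f • A) = L (f • e) * L A := by
  obtain ⟨L₀, hL₀, hL₀e, hL₀F⟩ := hM.exists_state hF
  have hL₀mem : (L₀ : V → ℝ) ∈ stateSet M e :=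
    ⟨fun A B => map_add _ _ _, fun c A => by simp, hL₀, hL₀e⟩
  obtain ⟨Lm, hLm, hmin⟩ := hM.isCompact_stateSet.exists_isMinOn ⟨_, hL₀mem⟩
    (continuous_apply F).continuousOn
  have hmin' : ∀ K ∈ stateSet M e, Lm F ≤ K F := fun K hK => hmin hK
  -- Restricting to the minimizers of `L F` before taking an extreme point keeps the value at `F`
  -- nonpositive.
  have hcomp : IsCompact (stateSet M e ∩ {L | L F = Lm F}) :=
    hM.isCompact_stateSet.inter_right (isClosed_eq (continuous_apply F) continuous_const)
  obtain ⟨E, hE⟩ := hcomp.extremePoints_nonempty ⟨Lm, hLm, rfl⟩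
  obtain ⟨⟨hEst, hEF⟩, hext⟩ := hE
  have hEF : E F = Lm F := hEF
  obtain ⟨hadd, hsmul, hpos, hone⟩ := id hEst
  let L : V →ₗ[ℝ] ℝ := { toFun := E, map_add' := hadd, map_smul' := hsmul }
  have hLE : ∀ A, L A = E A := fun A => rfl
  have hLpos : ∀ A ∈ M, 0 ≤ L A := hpos
  have hLone : L e = 1 := hone
  have hsq : ∀ (f : R) A, L (f ^ 2 • A) = L (f ^ 2 • e) * L A := by
    intro f A
    let Lf : V →ₗ[ℝ] ℝ := L ∘ₗ (LinearMap.lsmul R V (f ^ 2)).restrictScalars ℝ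
    have hLf : ∀ A, Lf A = L (f ^ 2 • A) := fun A => rfl
    have hLfpos : ∀ A ∈ M, 0 ≤ Lf A := fun A hA => hLpos _ (hM.sq_smul_mem f hA)
    obtain ⟨N, hN, hbd⟩ := hM.exists_sq_smul_le f
    have hbd := hbd L hLpos
    have hbde : Lf e ≤ N := by
      simpa [hLone, hLf] using hbd e hM.unit_mem
    rcases (hLfpos e hM.unit_mem).eq_or_lt with h0 | h0
    · rw [← hLf, ← hLf, hM.state_eq_zero hLfpos h0.symm, ← h0, zero_mul]
    -- `L` is a convex combination of the normalizations of `Lf` and `(N + 1) L - Lf`. Using `N + 1`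
    -- instead of `N` makes the second normalizing constant strictly positive.
    · set t := Lf e with ht
      have hd : 0 < N + 1 - t := by linarith
      have hst1 : (fun A => t⁻¹ * Lf A) ∈ stateSet M e := by
        refine ⟨fun A B => ?_, fun c A => ?_, fun A hA => ?_, inv_mul_cancel₀ h0.ne'⟩
        · simp only [map_add]; ring
        · simp only [map_smul, smul_eq_mul]; ring
        · exact mul_nonneg (inv_nonneg.2 h0.le) (hLfpos A hA)
      have hst2 : (fun A => (N + 1 - t)⁻¹ * ((N + 1) * L A - Lf A)) ∈ stateSet M e := by
        refine ⟨fun A B => ?_, fun c A => ?_, fun A hA => ?_, ?_⟩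
        · simp only [map_add]; ring
        · simp only [map_smul, smul_eq_mul]; ring
        · have h1 := hbd A hA
          have h2 := hLpos A hA
          rw [← hLf] at h1
          exact mul_nonneg (inv_nonneg.2 hd.le) (by linarith)
        · simp only [hLone, mul_one, ← ht]
          exact inv_mul_cancel₀ hd.ne'
      have hN1 : 0 < N + 1 := by linarith
      have hcomb : ∀ A, E A = t / (N + 1) * (t⁻¹ * Lf A)
          + (N + 1 - t) / (N + 1) * ((N + 1 - t)⁻¹ * ((N + 1) * L A - Lf A)) := by
        intro A
        rw [← hLE]
        field_simp
        ring
      have hw1 : 0 < t / (N + 1) := div_pos h0 hN1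
      have hw2 : 0 < (N + 1 - t) / (N + 1) := div_pos hd hN1
      have hw : t / (N + 1) + (N + 1 - t) / (N + 1) = 1 := by field_simp; ring
      have hm1 := hmin' _ hst1
      have hm2 := hmin' _ hst2
      have hcF := hcomb F
      rw [hEF] at hcF
      -- Both states take values at least the minimum at `F` and their weighted mean equals it, so
      -- both are minimizers and extremality applies.
      have hF1 : t⁻¹ * Lf F = Lm F := by
        refine le_antisymm ?_ hm1
        by_contra! hlt
        have := mul_lt_mul_of_pos_left hlt hw1
        have := mul_le_mul_of_nonneg_left hm2 hw2.le
        have h5 : (t / (N + 1) + (N + 1 - t) / (N + 1)) * Lm F = Lm F := by rw [hw, one_mul]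
        linarith
      have hF2 : (N + 1 - t)⁻¹ * ((N + 1) * L F - Lf F) = Lm F := by
        refine le_antisymm ?_ hm2
        by_contra! hlt
        have := mul_lt_mul_of_pos_left hlt hw2
        have h5 : (t / (N + 1) + (N + 1 - t) / (N + 1)) * Lm F = Lm F := by rw [hw, one_mul]
        rw [hF1] at hcF
        linarith
      have hEeq := hext ⟨hst1, hF1⟩ ⟨hst2, hF2⟩
        ⟨t / (N + 1), (N + 1 - t) / (N + 1), hw1, hw2, hw, funext fun A => (hcomb A).symm⟩
      have := congrFun hEeq A
      simp only [← hLE] at this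
      rw [← hLf, ← hLf, ← ht, ← this, mul_inv_cancel_left₀ h0.ne']
  refine ⟨L, hLpos, hLone, ?_, ?_⟩
  · rw [hLE, hEF]
    exact (hmin' _ hL₀mem).trans hL₀F
  · intro f A
    -- Polarization writes `f` as a difference of squares, so the case of squares suffices.
    have hpol : ∀ B : V, f • B = (4⁻¹ : ℝ) • ((f + 1) ^ 2 • B - (f - 1) ^ 2 • B) := by
      intro B
      rw [← sub_smul, show (f + 1) ^ 2 - (f - 1) ^ 2 = algebraMap ℝ R 4 * f by
        rw [map_ofNat]; ring, mul_smul, algebraMap_smul, smul_smul]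
      norm_num
    rw [hpol A, hpol e]
    simp only [map_smul, map_sub, hsq _ A, smul_eq_mul]
    ring

end IsArchimedeanCone

namespace PolyMat

/-! ### SOS matrices -/

section SOS

variable {n : ℕ} {ι κ : Type}

theorem isSOS_transpose_mul_self [Fintype κ] (T : PMatrix n κ ι) : IsSOS (Tᵀ * T) := by
  refine ⟨Fintype.card κ, T.submatrix (Fintype.equivFin κ).symm id, ?_⟩
  rw [transpose_submatrix, submatrix_mul_equiv, submatrix_id_id]

theorem IsSOS.zero : IsSOS (0 : PMatrix n ι ι) :=
  ⟨0, 0, by simp⟩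

theorem IsSOS.add {S T : PMatrix n ι ι} (hS : IsSOS S) (hT : IsSOS T) : IsSOS (S + T) := by
  obtain ⟨s, A, rfl⟩ := hS
  obtain ⟨t, B, rfl⟩ := hT
  convert isSOS_transpose_mul_self (fromRows A B) using 1
  rw [transpose_fromRows, fromCols_mul_fromRows]

theorem IsSOS.sum {σ : Type*} (s : Finset σ) {S : σ → PMatrix n ι ι} (hS : ∀ i ∈ s, IsSOS (S i)) :
    IsSOS (∑ i ∈ s, S i) :=
  Finset.sum_induction _ IsSOS (fun _ _ => IsSOS.add) IsSOS.zero hS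

theorem IsSOS.congr [Fintype ι] {S : PMatrix n ι ι} (hS : IsSOS S) (T : PMatrix n κ ι) :
    IsSOS (T * S * Tᵀ) := by
  obtain ⟨s, A, rfl⟩ := hS
  refine ⟨s, A * Tᵀ, ?_⟩
  simp only [transpose_mul, transpose_transpose, Matrix.mul_assoc]

theorem IsSOS.smul {S : PMatrix n ι ι} (hS : IsSOS S) {c : ℝ} (hc : 0 ≤ c) : IsSOS (c • S) := by
  obtain ⟨s, A, rfl⟩ := hS
  refine ⟨s, √c • A, ?_⟩
  rw [transpose_smul, smul_mul, Matrix.mul_smul, smul_smul, Real.mul_self_sqrt hc]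

theorem IsSOS.isSymm {S : PMatrix n ι ι} (hS : IsSOS S) : Sᵀ = S := by
  obtain ⟨s, A, rfl⟩ := hS
  simp

end SOS

/-! ### The `p`-product -/

section PProduct

variable {A : Type} [CommRing A] {p q : ℕ}

theorem pProduct_apply (C : Matrix (Fin p × Fin q) (Fin p × Fin q) A) (D : Matrix (Fin q) (Fin q) A)
    (i j : Fin p) : pProduct C D i j = ∑ a, ∑ b, C (i, a) (j, b) * D a b := by
  rw [Finset.sum_comm]
  simp [pProduct, block, Matrix.trace, Matrix.mul_apply]

theorem pProduct_add (C C' : Matrix (Fin p × Fin q) (Fin p × Fin q) A)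
    (D : Matrix (Fin q) (Fin q) A) : pProduct (C + C') D = pProduct C D + pProduct C' D := by
  ext i j
  simp only [pProduct_apply, Matrix.add_apply, add_mul, Finset.sum_add_distrib]

theorem pProduct_zero (D : Matrix (Fin q) (Fin q) A) :
    pProduct (0 : Matrix (Fin p × Fin q) (Fin p × Fin q) A) D = 0 := by
  ext i j
  simp [pProduct_apply]

theorem pProduct_sum {σ : Type*} (s : Finset σ)
    (C : σ → Matrix (Fin p × Fin q) (Fin p × Fin q) A) (D : Matrix (Fin q) (Fin q) A) :
    pProduct (∑ i ∈ s, C i) D = ∑ i ∈ s, pProduct (C i) D :=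
  map_sum ({ toFun := fun C => pProduct C D, map_zero' := pProduct_zero D,
             map_add' := fun C C' => pProduct_add C C' D } : _ →+ Matrix (Fin p) (Fin p) A) C s

theorem pProduct_smul {K : Type*} [CommSemiring K] [Algebra K A] (c : K)
    (C : Matrix (Fin p × Fin q) (Fin p × Fin q) A) (D : Matrix (Fin q) (Fin q) A) :
    pProduct (c • C) D = c • pProduct C D := by
  ext i j
  simp only [pProduct_apply, Matrix.smul_apply, smul_mul_assoc, Finset.smul_sum]

theorem pProduct_map {B : Type} [CommRing B] (f : A →+* B)
    (C : Matrix (Fin p × Fin q) (Fin p × Fin q) A) (D : Matrix (Fin q) (Fin q) A) :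
    (pProduct C D).map f = pProduct (C.map f) (D.map f) := by
  ext i j
  simp [pProduct_apply]

theorem pProduct_transpose {C : Matrix (Fin p × Fin q) (Fin p × Fin q) A}
    {D : Matrix (Fin q) (Fin q) A} (hC : Cᵀ = C) (hD : Dᵀ = D) :
    (pProduct C D)ᵀ = pProduct C D := by
  ext i j
  rw [transpose_apply, pProduct_apply, pProduct_apply, Finset.sum_comm]
  refine Finset.sum_congr rfl fun a _ => Finset.sum_congr rfl fun b _ => ?_
  conv_lhs => rw [← hC, ← hD]
  rfl

/-- The matrix on the right is the Kronecker product `T ⊗ I_q`. This identity makes quadratic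
modules stable under congruence, also between different sizes `p`. -/
theorem mul_pProduct_mul_transpose {p' : ℕ} (T : Matrix (Fin p') (Fin p) A)
    (C : Matrix (Fin p × Fin q) (Fin p × Fin q) A) (D : Matrix (Fin q) (Fin q) A) :
    T * pProduct C D * Tᵀ = pProduct
      ((Matrix.of fun x y : _ × Fin q => if x.2 = y.2 then T x.1 y.1 else 0) * C *
        (Matrix.of fun x y : _ × Fin q => if x.2 = y.2 then T x.1 y.1 else 0)ᵀ) D := by
  ext i j
  simp only [pProduct_apply, Matrix.mul_apply, transpose_apply, Matrix.of_apply,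
    Fintype.sum_prod_type, ite_mul, zero_mul, mul_ite, mul_zero, Finset.sum_ite_eq,
    Finset.mem_univ, if_true, Finset.sum_mul, Finset.mul_sum]
  conv_rhs => enter [2, a]; rw [Finset.sum_comm]
  conv_rhs => rw [Finset.sum_comm]
  refine Finset.sum_congr rfl fun l _ => ?_
  conv_rhs => enter [2, a]; rw [Finset.sum_comm]
  conv_rhs => rw [Finset.sum_comm]
  refine Finset.sum_congr rfl fun k _ => ?_
  refine Finset.sum_congr rfl fun a _ => Finset.sum_congr rfl fun b _ => ?_
  ring

end PProduct

/-! ### Quadratic modules and the matrix Positivstellensatz -/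

section QuadraticModule

variable {n m p : ℕ} {q : Fin m → ℕ} {G : (k : Fin m) → PMatrix n (Fin (q k)) (Fin (q k))}

theorem IsSOS.mem_quadraticModule {S : PMatrix n (Fin p) (Fin p)} (hS : IsSOS S) :
    S ∈ quadraticModule p G :=
  ⟨S, 0, hS, fun _ => IsSOS.zero, by simp [pProduct_zero]⟩

theorem add_mem_quadraticModule {A B : PMatrix n (Fin p) (Fin p)} (hA : A ∈ quadraticModule p G)
    (hB : B ∈ quadraticModule p G) : A + B ∈ quadraticModule p G := by
  obtain ⟨S₀, S, hS₀, hS, rfl⟩ := hA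
  obtain ⟨T₀, T, hT₀, hT, rfl⟩ := hB
  refine ⟨S₀ + T₀, S + T, hS₀.add hT₀, fun k => (hS k).add (hT k), ?_⟩
  simp only [Pi.add_apply, pProduct_add, Finset.sum_add_distrib]
  abel

theorem congr_mem_quadraticModule {p' : ℕ} {A : PMatrix n (Fin p) (Fin p)}
    (hA : A ∈ quadraticModule p G) (T : PMatrix n (Fin p') (Fin p)) :
    T * A * Tᵀ ∈ quadraticModule p' G := by
  obtain ⟨S₀, S, hS₀, hS, rfl⟩ := hA
  refine ⟨T * S₀ * Tᵀ, _, hS₀.congr T, fun k => (hS k).congr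
    (Matrix.of fun x y : _ × Fin (q k) => if x.2 = y.2 then T x.1 y.1 else 0), ?_⟩
  simp only [← mul_pProduct_mul_transpose, Matrix.mul_add, Matrix.add_mul, Matrix.mul_sum,
    Matrix.sum_mul]

theorem smul_mem_quadraticModule {A : PMatrix n (Fin p) (Fin p)} (hA : A ∈ quadraticModule p G)
    {c : ℝ} (hc : 0 ≤ c) : c • A ∈ quadraticModule p G := by
  obtain ⟨S₀, S, hS₀, hS, rfl⟩ := hA
  refine ⟨c • S₀, c • S, hS₀.smul hc, fun k => (hS k).smul hc, ?_⟩
  simp only [Pi.smul_apply, pProduct_smul, smul_add, Finset.smul_sum]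

theorem sum_mem_quadraticModule {σ : Type*} (s : Finset σ) {A : σ → PMatrix n (Fin p) (Fin p)}
    (hA : ∀ i ∈ s, A i ∈ quadraticModule p G) : ∑ i ∈ s, A i ∈ quadraticModule p G :=
  Finset.sum_induction _ (· ∈ quadraticModule p G) (fun _ _ => add_mem_quadraticModule)
    IsSOS.zero.mem_quadraticModule hA

theorem isSymm_of_mem_quadraticModule (hG : ∀ k, (G k).IsSymm) {A : PMatrix n (Fin p) (Fin p)}
    (hA : A ∈ quadraticModule p G) : Aᵀ = A := by
  obtain ⟨S₀, S, hS₀, hS, rfl⟩ := hA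
  rw [transpose_add, transpose_sum, hS₀.isSymm]
  simp only [pProduct_transpose (hS _).isSymm (hG _)]

/-- The scalar polynomials in the quadratic module. -/
def scalarModule (G : (k : Fin m) → PMatrix n (Fin (q k)) (Fin (q k))) :
    Set (MvPolynomial (Fin n) ℝ) :=
  {f | (Matrix.of fun _ _ => f : PMatrix n (Fin 1) (Fin 1)) ∈ quadraticModule 1 G}

theorem add_mem_scalarModule {f g : MvPolynomial (Fin n) ℝ} (hf : f ∈ scalarModule G)
    (hg : g ∈ scalarModule G) : f + g ∈ scalarModule G :=
  add_mem_quadraticModule hf hg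

theorem sq_mul_mem_scalarModule {f : MvPolynomial (Fin n) ℝ} (hf : f ∈ scalarModule G)
    (h : MvPolynomial (Fin n) ℝ) : h ^ 2 * f ∈ scalarModule G := by
  have := congr_mem_quadraticModule hf (Matrix.of fun _ _ => h : PMatrix n (Fin 1) (Fin 1))
  rw [scalarModule, Set.mem_ofPred_eq]
  convert this using 1
  ext i j : 1
  simp [Matrix.mul_apply]
  ring

theorem C_mul_mem_scalarModule {f : MvPolynomial (Fin n) ℝ} (hf : f ∈ scalarModule G)
    {c : ℝ} (hc : 0 ≤ c) : C c * f ∈ scalarModule G := by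
  have := sq_mul_mem_scalarModule hf (C √c)
  rwa [← map_pow, Real.sq_sqrt hc] at this

theorem sq_mem_scalarModule (h : MvPolynomial (Fin n) ℝ) : h ^ 2 ∈ scalarModule G := by
  have := (isSOS_transpose_mul_self
    (Matrix.of fun _ _ => h : PMatrix n (Fin 1) (Fin 1))).mem_quadraticModule (G := G)
  rw [scalarModule, Set.mem_ofPred_eq]
  convert this using 1
  ext i j : 1
  simp [Matrix.mul_apply]
  ring

theorem C_mem_scalarModule {c : ℝ} (hc : 0 ≤ c) : C c ∈ scalarModule G := by
  have := sq_mem_scalarModule (G := G) (C √c)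
  rwa [← map_pow, Real.sq_sqrt hc] at this

theorem sum_mem_scalarModule {σ : Type*} (s : Finset σ) {f : σ → MvPolynomial (Fin n) ℝ}
    (hf : ∀ i ∈ s, f i ∈ scalarModule G) : ∑ i ∈ s, f i ∈ scalarModule G :=
  Finset.sum_induction _ (· ∈ scalarModule G) (fun _ _ => add_mem_scalarModule)
    (by simpa using C_mem_scalarModule le_rfl) hf

theorem smul_vecMulVec_mem_quadraticModule {f : MvPolynomial (Fin n) ℝ} (hf : f ∈ scalarModule G)
    (v : Fin p → MvPolynomial (Fin n) ℝ) : f • vecMulVec v v ∈ quadraticModule p G := by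
  have := congr_mem_quadraticModule hf (Matrix.of fun i _ => v i : PMatrix n (Fin p) (Fin 1))
  convert this using 1
  ext i j : 1
  simp [Matrix.mul_apply, vecMulVec_apply]
  ring

theorem smul_one_mem_quadraticModule {f : MvPolynomial (Fin n) ℝ} (hf : f ∈ scalarModule G) :
    f • (1 : PMatrix n (Fin p) (Fin p)) ∈ quadraticModule p G := by
  have := sum_mem_quadraticModule Finset.univ fun i (_ : i ∈ Finset.univ) =>
    smul_vecMulVec_mem_quadraticModule hf (Pi.single i 1 : Fin p → MvPolynomial (Fin n) ℝ)
  convert this using 1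
  ext i j : 1
  simp [Matrix.sum_apply, vecMulVec_apply, Matrix.one_apply, Pi.single_apply]

/-- Taking `v vᵀ` as the only nonzero multiplier gives `vᵀ G_k v`; this is what later places the
evaluation point in `K`. -/
theorem quadraticForm_mem_scalarModule (k : Fin m) (v : Fin (q k) → ℝ) :
    ∑ a, ∑ b, C (v a) * C (v b) * G k a b ∈ scalarModule G := by
  let T : PMatrix n (Fin 1) (Fin 1 × Fin (q k)) := Matrix.of fun _ x => C (v x.2)
  refine ⟨0, Pi.single k (Tᵀ * T), IsSOS.zero, fun l => ?_, ?_⟩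
  · by_cases h : l = k
    · subst h
      simpa using isSOS_transpose_mul_self T
    · simpa [h] using IsSOS.zero
  · rw [Fintype.sum_eq_single k fun l hl => by rw [Pi.single_eq_of_ne hl, pProduct_zero]]
    ext i j : 1
    simp [pProduct_apply, Matrix.mul_apply, T]

/-- `f` is bounded by a constant relative to the scalar quadratic module. -/
def IsBoundedFor (G : (k : Fin m) → PMatrix n (Fin (q k)) (Fin (q k)))
    (f : MvPolynomial (Fin n) ℝ) : Prop :=
  ∃ N : ℝ, 0 < N ∧ C N - f ∈ scalarModule G ∧ C N + f ∈ scalarModule G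

/-- Products of members are unavailable, but `2N(N² - f²) = (N + f)²(N - f) + (N - f)²(N + f)` uses
only square multiples. -/
theorem IsBoundedFor.exists_sq {f : MvPolynomial (Fin n) ℝ} (hf : IsBoundedFor G f) :
    ∃ N : ℝ, 0 < N ∧ C N - f ^ 2 ∈ scalarModule G := by
  obtain ⟨N, hN, h1, h2⟩ := hf
  refine ⟨N ^ 2, by positivity, ?_⟩
  have := C_mul_mem_scalarModule (add_mem_scalarModule (sq_mul_mem_scalarModule h1 (C N + f))
    (sq_mul_mem_scalarModule h2 (C N - f))) (c := (2 * N)⁻¹) (by positivity)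
  convert this using 1
  have hc : (C (2 * N)⁻¹ * C (2 * N) : MvPolynomial (Fin n) ℝ) = 1 := by
    rw [← map_mul, inv_mul_cancel₀ (by positivity), map_one]
  calc (C (N ^ 2) - f ^ 2 : MvPolynomial (Fin n) ℝ)
      = (C (2 * N)⁻¹ * C (2 * N)) * (C N ^ 2 - f ^ 2) := by rw [hc, one_mul, map_pow]
    _ = _ := by rw [map_mul C 2 N, show (C 2 : MvPolynomial (Fin n) ℝ) = 2 from map_ofNat C 2]; ring

theorem IsBoundedFor.sq {f : MvPolynomial (Fin n) ℝ} (hf : IsBoundedFor G f) :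
    IsBoundedFor G (f ^ 2) := by
  obtain ⟨N, hN, h⟩ := hf.exists_sq
  exact ⟨N, hN, h, add_mem_scalarModule (C_mem_scalarModule hN.le) (sq_mem_scalarModule f)⟩

theorem IsBoundedFor.add {f g : MvPolynomial (Fin n) ℝ} (hf : IsBoundedFor G f)
    (hg : IsBoundedFor G g) : IsBoundedFor G (f + g) := by
  obtain ⟨N, hN, h1, h2⟩ := hf
  obtain ⟨K, hK, h3, h4⟩ := hg
  refine ⟨N + K, by positivity, ?_, ?_⟩
  · convert add_mem_scalarModule h1 h3 using 1
    rw [map_add]; ring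
  · convert add_mem_scalarModule h2 h4 using 1
    rw [map_add]; ring

theorem IsBoundedFor.neg {f : MvPolynomial (Fin n) ℝ} (hf : IsBoundedFor G f) :
    IsBoundedFor G (-f) := by
  obtain ⟨N, hN, h1, h2⟩ := hf
  exact ⟨N, hN, by rwa [sub_neg_eq_add], by rwa [← sub_eq_add_neg]⟩

theorem IsBoundedFor.C_mul {f : MvPolynomial (Fin n) ℝ} (hf : IsBoundedFor G f) {c : ℝ}
    (hc : 0 < c) : IsBoundedFor G (C c * f) := by
  obtain ⟨N, hN, h1, h2⟩ := hf
  refine ⟨c * N, by positivity, ?_, ?_⟩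
  · convert C_mul_mem_scalarModule h1 hc.le using 1
    rw [map_mul]; ring
  · convert C_mul_mem_scalarModule h2 hc.le using 1
    rw [map_mul]; ring

theorem isBoundedFor_C (c : ℝ) : IsBoundedFor G (C c) := by
  refine ⟨|c| + 1, by positivity, ?_, ?_⟩
  · rw [← map_sub]
    exact C_mem_scalarModule (by linarith [le_abs_self c])
  · rw [← map_add]
    exact C_mem_scalarModule (by linarith [neg_abs_le c])

theorem IsBoundedFor.mul {f g : MvPolynomial (Fin n) ℝ} (hf : IsBoundedFor G f)
    (hg : IsBoundedFor G g) : IsBoundedFor G (f * g) := by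
  have h := ((hf.add hg).sq.add (hf.add hg.neg).sq.neg).C_mul (c := 4⁻¹) (by positivity)
  convert h using 1
  have hc : (C 4⁻¹ * 4 : MvPolynomial (Fin n) ℝ) = 1 := by
    rw [show (4 : MvPolynomial (Fin n) ℝ) = C 4 from (map_ofNat C 4).symm, ← map_mul]
    norm_num
  linear_combination (-(f * g)) * hc

theorem IsArchimedean.isBoundedFor_X (hG : IsArchimedean G) (i : Fin n) :
    IsBoundedFor G (X i) := by
  obtain ⟨a, ha, h⟩ := hG
  have h : C a - ∑ i, X i ^ 2 ∈ scalarModule G := h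
  have hi : C a - X i ^ 2 ∈ scalarModule G := by
    convert add_mem_scalarModule h (sum_mem_scalarModule (Finset.univ.erase i)
      fun j _ => sq_mem_scalarModule (X j)) using 1
    rw [← Finset.add_sum_erase _ _ (Finset.mem_univ i)]
    ring
  have hc : (C 2⁻¹ * 2 : MvPolynomial (Fin n) ℝ) = 1 := by
    rw [show (2 : MvPolynomial (Fin n) ℝ) = C 2 from (map_ofNat C 2).symm, ← map_mul]
    norm_num
  -- The constant comes from `(a + 1)/2 ∓ x = ((a - x²) + (x ∓ 1)²)/2`.
  refine ⟨2⁻¹ * (a + 1), by positivity, ?_, ?_⟩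
  · convert C_mul_mem_scalarModule (add_mem_scalarModule hi (sq_mem_scalarModule (X i - 1)))
      (c := 2⁻¹) (by positivity) using 1
    simp only [map_mul, map_add, map_one]
    linear_combination X i * hc
  · convert C_mul_mem_scalarModule (add_mem_scalarModule hi (sq_mem_scalarModule (X i + 1)))
      (c := 2⁻¹) (by positivity) using 1
    simp only [map_mul, map_add, map_one]
    linear_combination -X i * hc

theorem IsArchimedean.isBoundedFor (hG : IsArchimedean G) (f : MvPolynomial (Fin n) ℝ) :
    IsBoundedFor G f := by
  induction f using MvPolynomial.induction_on with
  | C c => exact isBoundedFor_C c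
  | add f g hf hg => exact hf.add hg
  | mul_X f i hf => exact hf.mul (hG.isBoundedFor_X i)

theorem pow_sub_sq_pow_mem_scalarModule {f : MvPolynomial (Fin n) ℝ} {N : ℝ} (hN : 0 ≤ N)
    (h : C N - f ^ 2 ∈ scalarModule G) (k : ℕ) :
    C (N ^ k) - f ^ (2 * k) ∈ scalarModule G := by
  induction k with
  | zero => simpa using C_mem_scalarModule (G := G) le_rfl
  | succ k ih =>
    convert add_mem_scalarModule (C_mul_mem_scalarModule ih hN)
      (sq_mul_mem_scalarModule h (f ^ k)) using 1
    rw [pow_succ, map_mul]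
    ring

/-- Members of the quadratic module are symmetric when the `G_k` are, so membership is tested on `A
+ Aᵀ`; this lets the cone have an order unit in the space of all matrices. -/
theorem IsArchimedean.isArchimedeanCone (hG : IsArchimedean G) (p : ℕ) :
    IsArchimedeanCone (R := MvPolynomial (Fin n) ℝ)
      {A : PMatrix n (Fin p) (Fin p) | A + Aᵀ ∈ quadraticModule p G} 1 where
  unit_mem := by
    have h : (1 : PMatrix n (Fin p) (Fin p)) ∈ quadraticModule p G := by
      simpa using (isSOS_transpose_mul_self (1 : PMatrix n (Fin p) (Fin p))).mem_quadraticModule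
    simpa using add_mem_quadraticModule h h
  add_mem := by
    intro A B hA hB
    rw [Set.mem_ofPred_eq, transpose_add, add_add_add_comm]
    exact add_mem_quadraticModule hA hB
  sq_smul_mem := by
    intro f A hA
    have h := congr_mem_quadraticModule hA (f • (1 : PMatrix n (Fin p) (Fin p)))
    rw [Set.mem_ofPred_eq]
    convert h using 1
    simp [smul_smul, pow_two]
  exists_sub_mem := by
    intro A
    induction A using Matrix.induction_on' with
    | h_zero => exact ⟨0, by simpa using IsSOS.zero.mem_quadraticModule⟩
    | h_add A B hA hB =>
      obtain ⟨c, hc⟩ := hA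
      obtain ⟨d, hd⟩ := hB
      refine ⟨c + d, ?_⟩
      rw [Set.mem_ofPred_eq] at hc hd ⊢
      convert add_mem_quadraticModule hc hd using 1
      rw [add_smul]
      simp only [transpose_sub, transpose_add]
      abel
    | h_std_basis i j f =>
      obtain ⟨g, rfl⟩ : ∃ g, f = C 2 * g := ⟨C 2⁻¹ * f, by
        rw [← mul_assoc, ← map_mul]; norm_num⟩
      obtain ⟨N, hN, h1, h2⟩ := hG.isBoundedFor g
      -- `1 - E_ii` is a symmetric idempotent, hence its own Gram matrix. These terms complete `(N -
      -- g)(e_i + e_j)(e_i + e_j)ᵀ + (N + g)(e_i - e_j)(e_i - e_j)ᵀ = 2N(E_ii + E_jj) - 2g(E_ij +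
      -- E_ji)` to `4N - 2g(E_ij + E_ji)`.
      have hcompl : ∀ i : Fin p,
          (C N : MvPolynomial (Fin n) ℝ) • (1 - Matrix.single i i 1) ∈ quadraticModule p G := by
        intro i
        rw [show (C N : MvPolynomial (Fin n) ℝ) = algebraMap ℝ _ N from rfl, algebraMap_smul]
        refine smul_mem_quadraticModule ?_ hN.le
        convert (isSOS_transpose_mul_self (1 - Matrix.single i i 1)).mem_quadraticModule using 1
        simp [Matrix.mul_sub, Matrix.sub_mul]
      have h3 := smul_vecMulVec_mem_quadraticModule h1
        (Pi.single i 1 + Pi.single j 1 : Fin p → MvPolynomial (Fin n) ℝ)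
      have h4 := smul_vecMulVec_mem_quadraticModule h2
        (Pi.single i 1 - Pi.single j 1 : Fin p → MvPolynomial (Fin n) ℝ)
      have h5 := add_mem_quadraticModule (hcompl i) (hcompl j)
      have h6 := add_mem_quadraticModule (add_mem_quadraticModule h3 h4)
        (add_mem_quadraticModule h5 h5)
      refine ⟨N + N, ?_⟩
      rw [Set.mem_ofPred_eq]
      convert h6 using 1
      have hs : ∀ i j : Fin p, Matrix.single i j (C 2 * g) = (2 * g) • Matrix.single i j 1 := by
        intro i j
        rw [smul_single, smul_eq_mul, mul_one, show (C 2 : MvPolynomial (Fin n) ℝ) = 2 from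
          map_ofNat C 2]
      have hN' : ((N + N) • 1 : PMatrix n (Fin p) (Fin p))
          = (C N + C N : MvPolynomial (Fin n) ℝ) • 1 := by
        rw [← map_add]
        exact (algebraMap_smul (MvPolynomial (Fin n) ℝ) (N + N) _).symm
      simp only [transpose_sub, transpose_smul, transpose_one, transpose_single, add_vecMulVec,
        vecMulVec_add, sub_vecMulVec, vecMulVec_sub, ← single_eq_single_vecMulVec_single,
        hs, hN']
      module
  exists_bound := by
    intro f
    obtain ⟨N, hN, h⟩ := (hG.isBoundedFor f).exists_sq
    refine ⟨N, hN, fun k => ?_⟩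
    have h1 := smul_one_mem_quadraticModule (p := p) (pow_sub_sq_pow_mem_scalarModule hN.le h k)
    rw [Set.mem_ofPred_eq]
    convert add_mem_quadraticModule h1 h1 using 1
    rw [sub_smul, show (C (N ^ k) : MvPolynomial (Fin n) ℝ) = algebraMap ℝ _ (N ^ k) from rfl,
      algebraMap_smul]
    simp

theorem map_C_mem_quadraticModule {P : Matrix (Fin p) (Fin p) ℝ} (hP : P.PosSemidef) :
    (P.map C : PMatrix n (Fin p) (Fin p)) ∈ quadraticModule p G := by
  obtain ⟨s, v, rfl⟩ := posSemidef_iff_eq_sum_vecMulVec.1 hP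
  have h := sum_mem_quadraticModule (G := G) Finset.univ fun i (_ : i ∈ Finset.univ) =>
    smul_vecMulVec_mem_quadraticModule (C_mem_scalarModule zero_le_one) (fun a => C (v i a))
  convert h using 1
  ext i j : 1
  simp [Matrix.sum_apply, vecMulVec_apply]

/-- A linear functional that is nonnegative on positive semidefinite matrices and positive on the
identity is positive on positive definite matrices. -/
theorem pos_of_posDef {ℓ : Matrix (Fin p) (Fin p) ℝ →ₗ[ℝ] ℝ} (hℓ : ∀ P, P.PosSemidef → 0 ≤ ℓ P)
    (hone : ℓ 1 = 1) {P : Matrix (Fin p) (Fin p) ℝ} (hP : P.PosDef) : 0 < ℓ P := by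
  have hd : 0 ≤ ℓ P⁻¹ := hℓ _ hP.inv.posSemidef
  have hu : IsUnit P.det := (isUnit_iff_isUnit_det _).1 hP.isUnit
  -- Apply `ℓ` to the positive semidefinite matrix `(1 - tP⁻¹) P (1 - tP⁻¹)`.
  have key : ∀ t : ℝ, 0 ≤ ℓ P - 2 * t + t ^ 2 * ℓ P⁻¹ := by
    intro t
    have h := hℓ _ (hP.posSemidef.conjTranspose_mul_mul_same (1 - t • P⁻¹))
    have hinv : P⁻¹ᴴ = P⁻¹ := hP.inv.isHermitian
    have h2 : (1 - t • P⁻¹)ᴴ * P * (1 - t • P⁻¹) = P - (2 * t) • 1 + t ^ 2 • P⁻¹ := by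
      rw [conjTranspose_sub, conjTranspose_smul, hinv, conjTranspose_one, star_trivial]
      simp only [Matrix.sub_mul, Matrix.mul_sub, Matrix.one_mul, Matrix.mul_one, smul_mul,
        Matrix.mul_smul, nonsing_inv_mul _ hu, mul_nonsing_inv _ hu]
      module
    rw [h2] at h
    simpa [hone] using h
  -- The `+ 1` keeps the denominator positive even if `ℓ P⁻¹ = 0`.
  have h := key (1 / (ℓ P⁻¹ + 1))
  have h3 : 0 < 2 * (1 / (ℓ P⁻¹ + 1)) - (1 / (ℓ P⁻¹ + 1)) ^ 2 * ℓ P⁻¹ := by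
    have : 2 * (1 / (ℓ P⁻¹ + 1)) - (1 / (ℓ P⁻¹ + 1)) ^ 2 * ℓ P⁻¹
        = (ℓ P⁻¹ + 2) / (ℓ P⁻¹ + 1) ^ 2 := by
      field_simp; ring
    rw [this]; positivity
  linarith

/-- The Positivstellensatz of Scherer and Hol: a symmetric polynomial matrix that is positive
definite on `K` lies in the quadratic module, if the latter is Archimedean. -/
theorem IsArchimedean.mem_quadraticModule (hArch : IsArchimedean G) (hG : ∀ k, (G k).IsSymm)
    {F : PMatrix n (Fin p) (Fin p)} (hF : F.IsSymm)
    (hpos : ∀ x ∈ semialgebraicSet G, (evalAt F x).PosDef) : F ∈ quadraticModule p G := by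
  have hM := hArch.isArchimedeanCone p
  suffices h : F ∈ {A : PMatrix n (Fin p) (Fin p) | A + Aᵀ ∈ quadraticModule p G} by
    rw [Set.mem_ofPred_eq, hF.eq] at h
    have h2 := smul_mem_quadraticModule h (c := 2⁻¹) (by positivity)
    rw [← two_smul ℝ F, smul_smul] at h2
    norm_num at h2
    exact h2
  by_contra hFM
  obtain ⟨L, hL, hone, hLF, hmul⟩ := hM.exists_multiplicative_state hFM
  have hLQ : ∀ A ∈ quadraticModule p G, 0 ≤ L A := by
    intro A hA
    refine hL A ?_
    rw [Set.mem_ofPred_eq, isSymm_of_mem_quadraticModule hG hA]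
    exact add_mem_quadraticModule hA hA
  -- Multiplicativity makes `f ↦ L (f • 1)` an algebra homomorphism to `ℝ`, hence evaluation at a
  -- point.
  let χ : MvPolynomial (Fin n) ℝ →ₐ[ℝ] ℝ := AlgHom.ofLinearMap
    (L ∘ₗ (LinearMap.toSpanSingleton (MvPolynomial (Fin n) ℝ)
      (PMatrix n (Fin p) (Fin p)) 1).restrictScalars ℝ)
    (by simpa using hone) (fun f g => by simpa [mul_smul] using hmul f (g • 1))
  let x : Fin n → ℝ := fun i => χ (X i)
  have hχ : ∀ f : MvPolynomial (Fin n) ℝ, L (f • 1) = eval x f := by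
    intro f
    have h1 : χ = aeval x := algHom_ext fun i => by simp [x]
    have h2 : χ f = aeval x f := by rw [h1]
    rwa [aeval_eq_eval] at h2
  have hx : x ∈ semialgebraicSet G := by
    intro k
    refine PosSemidef.of_dotProduct_mulVec_nonneg ?_ fun v => ?_
    · rw [IsHermitian, conjTranspose_eq_transpose_of_trivial, evalAt, ← transpose_map, (hG k).eq]
    · have h := hLQ _ (smul_one_mem_quadraticModule (quadraticForm_mem_scalarModule (G := G) k v))
      rw [hχ] at h
      refine h.trans_eq ?_
      simp only [dotProduct, mulVec, evalAt, Matrix.map_apply, map_sum, map_mul, eval_C,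
        Finset.mul_sum, star_trivial, Pi.star_apply]
      refine Finset.sum_congr rfl fun a _ => Finset.sum_congr rfl fun b _ => ?_
      ring
  have hsum : ∀ A, L A = ∑ i, ∑ j, eval x (A i j) * L (Matrix.single i j 1) := by
    intro A
    conv_lhs => rw [matrix_eq_sum_single A]
    simp only [map_sum]
    refine Finset.sum_congr rfl fun i _ => Finset.sum_congr rfl fun j _ => ?_
    rw [← hχ, ← hmul, smul_single, smul_eq_mul, mul_one]
  have hLF' : L F = L ((evalAt F x).map C) := by
    rw [hsum F, hsum ((evalAt F x).map C)]
    simp [evalAt]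
  let ℓ : Matrix (Fin p) (Fin p) ℝ →ₗ[ℝ] ℝ :=
    L ∘ₗ (Algebra.linearMap ℝ (MvPolynomial (Fin n) ℝ)).mapMatrix
  have hℓ : ∀ P, ℓ P = L (P.map C) := fun P => rfl
  have := pos_of_posDef (ℓ := ℓ) (fun P hP => hLQ _ (map_C_mem_quadraticModule hP))
    (by rw [hℓ, Matrix.map_one _ (map_zero C) (map_one C), hone]) (hpos x hx)
  rw [hℓ, ← hLF'] at this
  linarith

end QuadraticModule

end PolyMat

namespace PolyMat

/-! ### Sign changes and their action on coefficients -/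

section SignChange

variable {n : ℕ}

/-- The substitution `x_i ↦ θ_i x_i`. -/
noncomputable def signChange (θ : Fin n → ℤˣ) :
    MvPolynomial (Fin n) ℝ →ₐ[ℝ] MvPolynomial (Fin n) ℝ :=
  aeval fun i => C ((θ i : ℤ) : ℝ) * X i

theorem eval_signChange (θ : Fin n → ℤˣ) (f : MvPolynomial (Fin n) ℝ) (x : Fin n → ℝ) :
    eval x (signChange θ f) = eval (fun i => ((θ i : ℤ) : ℝ) * x i) f := by
  induction f using MvPolynomial.induction_on with
  | C c => simp [signChange]
  | add f g hf hg => simp [hf, hg]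
  | mul_X f i hf => simp [hf]; simp [signChange]

theorem signChange_mul (θ η : Fin n → ℤˣ) (f : MvPolynomial (Fin n) ℝ) :
    signChange (θ * η) f = signChange θ (signChange η f) := by
  refine MvPolynomial.funext fun x => ?_
  simp only [eval_signChange]
  congr 2
  ext i
  simp
  ring

theorem coeff_signChange (θ : Fin n → ℤˣ) (f : MvPolynomial (Fin n) ℝ) (α : Fin n →₀ ℕ) :
    coeff α (signChange θ f) = (∏ i, ((θ i : ℤ) : ℝ) ^ α i) * coeff α f := by
  induction f using MvPolynomial.induction_on' with
  | add f g hf hg => simp [hf, hg, mul_add]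
  | monomial β c =>
    have h : signChange θ (monomial β c) = C (∏ i, ((θ i : ℤ) : ℝ) ^ β i) * monomial β c := by
      rw [signChange, aeval_monomial, monomial_eq, Finsupp.prod_fintype _ _ (by simp),
        Finsupp.prod_fintype _ _ (by simp)]
      simp only [mul_pow, Finset.prod_mul_distrib, map_prod, map_pow, algebraMap_eq]
      ring
    rw [h, coeff_C_mul]
    by_cases hαβ : β = α
    · subst hαβ; rfl
    · simp [coeff_monomial, hαβ]

theorem IsSignSymmetry.map_eq {ι : Type} {P : PMatrix n ι ι} {θ : Fin n → ℤˣ}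
    (h : IsSignSymmetry P θ) : P.map (signChange θ) = P := by
  ext i j : 1
  refine MvPolynomial.funext (R := ℝ) fun x => ?_
  rw [Matrix.map_apply, eval_signChange]
  exact (congrFun (congrFun (h x) i) j).symm

theorem isSignSymmetry_one {ι : Type} (P : PMatrix n ι ι) : IsSignSymmetry P 1 := by
  intro x; simp

theorem IsSignSymmetry.mul {ι : Type} {P : PMatrix n ι ι} {θ η : Fin n → ℤˣ}
    (hθ : IsSignSymmetry P θ) (hη : IsSignSymmetry P η) : IsSignSymmetry P (θ * η) := by
  intro x
  rw [hη x, hθ]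
  congr 1
  ext i
  simp [mul_assoc]

theorem even_of_prod_sign_pow_eq_one (θ : Fin n → ℤˣ) (α : Fin n →₀ ℕ)
    (h : ∏ i, ((θ i : ℤ) : ℝ) ^ α i = 1) :
    ∑ i, (if θ i = -1 then 1 else 0 : ZMod 2) * (α i : ZMod 2) = 0 := by
  have h1 : ∀ i, ((θ i : ℤ) : ℝ) ^ α i = (-1) ^ ((if θ i = -1 then 1 else 0) * α i) := by
    intro i
    rcases Int.units_eq_one_or (θ i) with hi | hi <;> simp [hi]
  simp only [h1, Finset.prod_pow_eq_pow_sum] at h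
  rw [neg_one_pow_eq_one_iff_even (by norm_num)] at h
  have h2 := (ZMod.natCast_eq_zero_iff_even).2 h
  push_cast at h2
  exact h2

end SignChange

end PolyMat

namespace PolyMat

/-! ### Averaging over sign symmetries -/

section Average

variable {n m p : ℕ} {q : Fin m → ℕ}

theorem IsSOS.map {ι : Type} {S : PMatrix n ι ι} (hS : IsSOS S)
    (f : MvPolynomial (Fin n) ℝ →+* MvPolynomial (Fin n) ℝ) : IsSOS (S.map f) := by
  obtain ⟨s, A, rfl⟩ := hS
  exact ⟨s, A.map f, by rw [Matrix.map_mul, transpose_map]⟩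

/-- The average of `S` over a finite set of sign changes. -/
noncomputable def signAverage {ι : Type} (Γ : Finset (Fin n → ℤˣ)) (S : PMatrix n ι ι) :
    PMatrix n ι ι :=
  (Γ.card : ℝ)⁻¹ • ∑ θ ∈ Γ, S.map (signChange θ)

theorem IsSOS.signAverage {ι : Type} (Γ : Finset (Fin n → ℤˣ)) {S : PMatrix n ι ι}
    (hS : IsSOS S) : IsSOS (signAverage Γ S) :=
  (IsSOS.sum _ fun θ _ => hS.map (signChange θ : _ →+* _)).smul (by positivity)

theorem signAverage_eq_self {ι : Type} {Γ : Finset (Fin n → ℤˣ)} (hΓ : Γ.Nonempty)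
    {P : PMatrix n ι ι} (h : ∀ θ ∈ Γ, P.map (signChange θ) = P) : signAverage Γ P = P := by
  have hc : (Γ.card : ℝ) ≠ 0 := Nat.cast_ne_zero.2 hΓ.card_pos.ne'
  rw [signAverage, Finset.sum_congr rfl h, Finset.sum_const, ← Nat.cast_smul_eq_nsmul ℝ, smul_smul,
    inv_mul_cancel₀ hc, one_smul]

theorem signAverage_add {ι : Type} (Γ : Finset (Fin n → ℤˣ)) (S T : PMatrix n ι ι) :
    signAverage Γ (S + T) = signAverage Γ S + signAverage Γ T := by
  simp only [signAverage, ← smul_add, ← Finset.sum_add_distrib]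
  congr 1
  refine Finset.sum_congr rfl fun θ _ => ?_
  rw [Matrix.map_add _ (map_add _)]

theorem signAverage_zero {ι : Type} (Γ : Finset (Fin n → ℤˣ)) :
    signAverage Γ (0 : PMatrix n ι ι) = 0 := by
  simp [signAverage]

theorem signAverage_sum {ι : Type} {σ : Type*} (Γ : Finset (Fin n → ℤˣ)) (s : Finset σ)
    (S : σ → PMatrix n ι ι) : signAverage Γ (∑ i ∈ s, S i) = ∑ i ∈ s, signAverage Γ (S i) :=
  map_sum ({ toFun := signAverage Γ, map_zero' := signAverage_zero Γ,
             map_add' := signAverage_add Γ } : PMatrix n ι ι →+ PMatrix n ι ι) S s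

/-- Since `D` is invariant, each substitution acts on the product only through `S`. -/
theorem signAverage_pProduct {r : ℕ} {Γ : Finset (Fin n → ℤˣ)}
    (S : PMatrix n (Fin p × Fin r) (Fin p × Fin r)) {D : PMatrix n (Fin r) (Fin r)}
    (hD : ∀ θ ∈ Γ, D.map (signChange θ) = D) :
    signAverage Γ (pProduct S D) = pProduct (signAverage Γ S) D := by
  rw [signAverage, signAverage, pProduct_smul, pProduct_sum]
  congr 1
  refine Finset.sum_congr rfl fun θ hθ => ?_
  have h := pProduct_map (signChange θ : MvPolynomial (Fin n) ℝ →+* MvPolynomial (Fin n) ℝ) S D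
  simp only [RingHom.coe_coe, hD θ hθ] at h
  exact h

/-- Left translation by `η` is injective, so it permutes the finite set `Γ` and only reindexes the
sum. -/
theorem signAverage_map {ι : Type} {Γ : Finset (Fin n → ℤˣ)} {η : Fin n → ℤˣ}
    (hη : ∀ θ ∈ Γ, η * θ ∈ Γ) (S : PMatrix n ι ι) :
    (signAverage Γ S).map (signChange η) = signAverage Γ S := by
  have himage : Γ.map (mulLeftEmbedding η) = Γ := by
    refine Finset.eq_of_subset_of_card_le (fun θ hθ => ?_) (Finset.card_map _).ge
    obtain ⟨ζ, hζ, rfl⟩ := Finset.mem_map.1 hθ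
    exact hη ζ hζ
  conv_rhs => rw [signAverage, ← himage, Finset.card_map, Finset.sum_map]
  ext i j : 1
  simp only [signAverage, Matrix.map_apply, Matrix.smul_apply, Matrix.sum_apply, map_smul, map_sum,
    mulLeftEmbedding_apply, signChange_mul]

theorem prod_sign_pow_eq_one {ι : Type} {S : PMatrix n ι ι} {η : Fin n → ℤˣ}
    (h : S.map (signChange η) = S) {α : Fin n →₀ ℕ} (hα : α ∈ supp S) :
    ∏ i, ((η i : ℤ) : ℝ) ^ α i = 1 := by
  by_contra hne
  refine hα (Matrix.ext fun i j => ?_)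
  have h1 := congrArg (coeff α) (congrFun (congrFun h i) j)
  rw [Matrix.map_apply, coeff_signChange] at h1
  by_contra hne0
  exact hne ((mul_eq_right₀ hne0).1 h1)

end Average

end PolyMat

/-! ### Symmetrizing the certificate -/

theorem mainTheorem9 (n m p : ℕ) (q : Fin m → ℕ)
    (F : PolyMat.PMatrix n (Fin p) (Fin p)) (hF : F.IsSymm)
    (G : (k : Fin m) → PolyMat.PMatrix n (Fin (q k)) (Fin (q k))) (hG : ∀ k, (G k).IsSymm)
    (hArch : PolyMat.IsArchimedean G)
    (hpos : ∀ x ∈ PolyMat.semialgebraicSet G, (PolyMat.evalAt F x).PosDef) :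
    ∃ (S₀ : PolyMat.PMatrix n (Fin p) (Fin p))
      (S : (k : Fin m) → PolyMat.PMatrix n (Fin p × Fin (q k)) (Fin p × Fin (q k))),
      PolyMat.IsSOS S₀ ∧ (∀ k, PolyMat.IsSOS (S k)) ∧
      F = S₀ + ∑ k, PolyMat.pProduct (S k) (G k) ∧
      (∀ α ∈ PolyMat.supp S₀, PolyMat.IsEvenFor (PolyMat.signMatrix F G) α) ∧
      (∀ k, ∀ α ∈ PolyMat.supp (S k), PolyMat.IsEvenFor (PolyMat.signMatrix F G) α) := by
  classical
  obtain ⟨S₀, S, hS₀, hS, hFS⟩ := hArch.mem_quadraticModule hG hF hpos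
  let Γ : Finset (Fin n → ℤˣ) := (PolyMat.commonSignSymmetries F G).toFinset
  have hΓ : ∀ θ, θ ∈ Γ ↔ PolyMat.IsSignSymmetry F θ ∧ ∀ k, PolyMat.IsSignSymmetry (G k) θ :=
    fun θ => Set.mem_toFinset
  have hne : Γ.Nonempty := ⟨1, (hΓ 1).2
    ⟨PolyMat.isSignSymmetry_one _, fun _ => PolyMat.isSignSymmetry_one _⟩⟩
  have hmul : ∀ η ∈ Γ, ∀ θ ∈ Γ, η * θ ∈ Γ := fun η hη θ hθ => (hΓ _).2
    ⟨((hΓ η).1 hη).1.mul ((hΓ θ).1 hθ).1, fun k => (((hΓ η).1 hη).2 k).mul (((hΓ θ).1 hθ).2 k)⟩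
  have heven : ∀ {ι : Type} (T : PolyMat.PMatrix n ι ι),
      ∀ α ∈ PolyMat.supp (PolyMat.signAverage Γ T),
        PolyMat.IsEvenFor (PolyMat.signMatrix F G) α := by
    intro ι T α hα
    -- Each common sign symmetry `η` is one row of `Rᵀ`, that is, one congruence on `α`.
    ext ⟨η, hη⟩
    have h := PolyMat.prod_sign_pow_eq_one
      (PolyMat.signAverage_map (hmul η (Set.mem_toFinset.2 hη)) T) hα
    simpa [mulVec, dotProduct, PolyMat.signMatrix] using
      PolyMat.even_of_prod_sign_pow_eq_one η α h
  refine ⟨PolyMat.signAverage Γ S₀, fun k => PolyMat.signAverage Γ (S k), hS₀.signAverage Γ,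
    fun k => (hS k).signAverage Γ, ?_, heven S₀, fun k => heven (S k)⟩
  have h := PolyMat.signAverage_eq_self hne fun θ hθ => ((hΓ θ).1 hθ).1.map_eq
  rw [hFS, PolyMat.signAverage_add, PolyMat.signAverage_sum, ← hFS] at h
  rw [← h]
  congr 1
  refine Finset.sum_congr rfl fun k _ => ?_
  exact PolyMat.signAverage_pProduct _ fun θ hθ => (((hΓ θ).1 hθ).2 k).map_eq
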